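/- Let $k$ be a field of characteristic zero, $Q$ a finite quiver, $J$ the two-sided ideal of the path algebra $kQ$ generated by the arrows, $n\ge 2$, and $A=kQ/J^n$. Put $E=kQ_0$, so $A=E\oplus\operatorname{rad}A$; $\otimes$ of paths is over $E$. **Complexes.** Let $\overline C_m=A\otimes_E(\operatorname{rad}A)^{\otimes_E m}\otimes_E A$ be the reduced bar resolution, with differential $d$ (alternating sum of products of neighbouring factors) and contracting homotopy $s(a\otimes x)=1\otimes a_r\otimes x$, where $a_r$ is the component of $a$ in $\operatorname{rad}A$. Let $P_m=A\otimes_E kAP_m\otimes_E A$ be Bardzell's resolution, where $AP_m$ is the set of supports of $m$-concatenations of relations; here $AP_0=Q_0$, $AP_1=Q_1$, and $AP_{2c}$ (resp. $AP_{2c+1}$) is the set of paths of length $cn$ (resp. $cn+1$). For $m$ even, $\delta_m(1\otimes\psi\otimes1)=\sum a\otimes\psi'\otimes b$ over all factorizations $\psi=a\psi'b$ with $\psi'\in AP_{m-1}$; for $m$ odd, it is $\alpha\otimes\psi'\otimes1-1\otimes\psi''\otimes\beta$, where $\psi=\alpha\psi'=\psi''\beta$ with $\psi',\psi''\in AP_{m-1}$.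 Let $\overline C^m=\operatorname{Hom}_{E-E}((\operatorname{rad}A)^{\otimes_E m},A)$ and $B^m(A)=\operatorname{Hom}_{E-E}(kAP_m,A)$. In the shifted complexes $\overline C^*[1]$ and $B^*(A)[1]$ the elements of $\overline C^{m}$ and $B^{m}(A)$ have degree $m-1$; $B^*(A)[1]$ has the differential $f\mapsto-(-1)^m\hat f\delta_{m+1}$ on $B^m(A)$, where $\hat f$ is the bimodule map extending $f$; and $\overline C^*[1]$ has the Gerstenhaber bracket $[f,g]=f\circ g-(-1)^{(p-1)(q-1)}g\circ f$ for $f\in\overline C^p$, $g\in\overline C^q$, where $f\circ g=\sum_{i=0}^{p-1}(-1)^{i(q+1)}f(\mathrm{Id}^{\otimes i}\otimes g\otimes\mathrm{Id}^{\otimes p-i-1})$ and the values of the inner cochain are projected to $\operatorname{rad}A$. **Contraction.** Let $F_0=\mathrm{Id}$ and $F_m(1\otimes\psi\otimes1)=sF_{m-1}\delta_m(1\otimes\psi\otimes1)$. For nontrivial paths $v_i$ of length less than $n$ with $v_1\cdots v_m$ a path in $Q$: if $m$ is even, $G_m(1\otimes v_1\otimes\cdots\otimes v_m\otimes1)=1\otimes\psi\otimes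 b$ with $\psi\in AP_m$, $v_1\cdots v_m=\psi b$, when $v_1v_2=v_3v_4=\dots=v_{m-1}v_m=0$ in $A$, and $0$ otherwise; if $m$ is odd, it is $\sum a\otimes\psi\otimes b$ over all factorizations $v_1\cdots v_m=a\psi b$ with $\psi\in AP_m$ starting before the end of $v_1$, when $v_2v_3=\dots=v_{m-1}v_m=0$ in $A$, and $0$ otherwise. Let $H_0=0$ and $H_m(1\otimes x)=(sF_mG_m-sH_{m-1}d)(1\otimes x)$. All these are extended to $A$-bimodule maps. On cochains, $F^m(f)=\hat fF_m$, $G^m(f)=\hat fG_m$ and $H^m(f)=(-1)^{m-1}\hat fH_{m-1}$. **Brackets.** For homogeneous elements of $B^*(A)[1]$ put $\phi_1=G^*$, let $l_1$ be the differential, and for $r\ge2$ $$v_r=\sum_{t=1}^{r-1}\ \sum_{\tau\in\mathbb S^-_{t,r-t}}\chi(\tau)\kappa(\tau)_t\,[\phi_t,\phi_{r-t}]\hat\tau,\qquad l_r=F^*v_r,$$ $$u_r=\sum_{j=2}^{r}\ \sum_{\tau\in\mathbb S_{j,r-j}}(-1)^{j(r-j)+1}\chi(\tau)\,\phi_{r-j+1}(l_j\otimes\mathrm{Id}^{\otimes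 r-j})\hat\tau,\qquad \phi_r=H^*(u_r+v_r).$$ Here $\mathbb S_{t,r-t}$ is the set of $(t,r-t)$-unshuffles, $\mathbb S^-_{t,r-t}$ the set of those with $\tau(1)<\tau(t+1)$, $\hat\tau$ permutes the arguments ($f_1\otimes\cdots\otimes f_r\mapsto f_{\tau(1)}\otimes\cdots\otimes f_{\tau(r)}$), $\chi(\tau)$ is the antisymmetric Koszul sign, and $\kappa(\tau)_t=(-1)^{(t-1)+(r-t-1)\sum_{p\le t}|f_{\tau(p)}|}$. **Proposition.** For all $m\ge3$ and all $f_1,\dots,f_m\in B^1(A)[1]=\operatorname{Hom}_{E-E}(kAP_2,A)$, $$l_m(f_1\otimes\cdots\otimes f_m)=0.$$ Consequently, an element $f\in B^1(A)[1]$ satisfies the generalized Maurer–Cartan equation $l_1(f)-\sum_{r\ge2}(-1)^{r(r+1)/2}\frac1{r!}\,l_r(f\otimes\cdots\otimes f)=0$ (where the sum is required to have only finitely many nonzero terms) if and only if $l_1(f)+\tfrac12\,l_2(f\otimes f)=0$. -/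

import Mathlib

/-!
Truncated quiver algebras, their reduced bar resolution and their Bardzell resolution, the
contraction between the Hochschild complex and the Bardzell complex, and the higher brackets
`l_n` that the contraction transfers to the shifted Bardzell complex.
-/

universe u v w

noncomputable section

namespace TruncatedQuiver

open scoped Classical

/-! ### Paths -/

section Paths

/-- Finite sequences of arrows (of a quiver with vertex set `V`). -/
abbrev Word (V : Type u) [Quiver.{v} V] := List (Quiver.Total V)

variable {V : Type u} [Quiver.{v} V]

/-- The arrows `α₁ … α_l` form a path starting at the vertex `e`. -/
def IsWalk : V → Word V → Prop
  | _, [] => True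
  | e, α :: p => α.left = e ∧ IsWalk α.right p

/-- The last vertex of a path with first vertex `e`. -/
def walkEnd : V → Word V → V
  | e, [] => e
  | _, α :: p => walkEnd α.right p

theorem isWalk_append (e : V) (p q : Word V) :
    IsWalk e (p ++ q) ↔ IsWalk e p ∧ IsWalk (walkEnd e p) q := by
  induction p generalizing e with
  | nil => simp [IsWalk, walkEnd]
  | cons α p ih => simp [IsWalk, walkEnd, ih, and_assoc]

theorem walkEnd_append (e : V) (p q : Word V) :
    walkEnd e (p ++ q) = walkEnd (walkEnd e p) q := by
  induction p generalizing e with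
  | nil => rfl
  | cons α p ih => simp [walkEnd, ih]

variable (V) in
/-- Paths in the quiver, including the trivial path at each vertex. -/
@[ext] structure QPath where
  start : V
  arrows : Word V
  isWalk : IsWalk start arrows

namespace QPath

/-- The target of a path. -/
def tgt (p : QPath V) : V := walkEnd p.start p.arrows

/-- The number of arrows. -/
def length (p : QPath V) : ℕ := p.arrows.length

/-- The trivial path at `e`. -/
def vertex (e : V) : QPath V := ⟨e, [], trivial⟩

/-- The path of length one given by an arrow. -/
def ofArrow (α : Quiver.Total V) : QPath V := ⟨α.left, [α], rfl, trivial⟩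

/-- Concatenation: first `p`, then `q`. -/
def comp (p q : QPath V) (h : p.tgt = q.start) : QPath V :=
  ⟨p.start, p.arrows ++ q.arrows, (isWalk_append _ _ _).2 ⟨p.isWalk, by
    have := q.isWalk; rw [← h] at this; exact this⟩⟩

theorem tgt_comp (p q : QPath V) (h : p.tgt = q.start) : (p.comp q h).tgt = q.tgt := by
  simp only [tgt, comp, walkEnd_append]
  have : walkEnd p.start p.arrows = q.start := h
  rw [this]

end QPath

end Paths

/-! ### The path algebra and the truncated algebra -/

section Algebra

/-- The path algebra `kQ`: the vector space with basis the paths of `Q`. -/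
def PathAlgebra (k : Type w) [Field k] (V : Type u) [Quiver.{v} V] := QPath V →₀ k

variable (k : Type w) [Field k] (V : Type u) [Quiver.{v} V]

instance : AddCommGroup (PathAlgebra k V) := inferInstanceAs (AddCommGroup (QPath V →₀ k))

instance : Module k (PathAlgebra k V) := inferInstanceAs (Module k (QPath V →₀ k))

variable {V}

/-- A path as a basis element of the path algebra. -/
def PathAlgebra.of (p : QPath V) : PathAlgebra k V := Finsupp.single p (1 : k)

/-- The product of two paths: their concatenation, or `0` if they are not composable. -/
def pathMul (p q : QPath V) : PathAlgebra k V :=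
  if h : p.tgt = q.start then PathAlgebra.of k (p.comp q h) else 0

/-- The multiplication of the path algebra, as a bilinear map. -/
def mulHom : PathAlgebra k V →ₗ[k] PathAlgebra k V →ₗ[k] PathAlgebra k V :=
  Finsupp.linearCombination k fun p : QPath V =>
    (Finsupp.linearCombination k fun q : QPath V => pathMul k p q :
      PathAlgebra k V →ₗ[k] PathAlgebra k V)

instance : Mul (PathAlgebra k V) := ⟨fun x y => mulHom k x y⟩

theorem PathAlgebra.mul_def (x y : PathAlgebra k V) : x * y = mulHom k x y := rfl

theorem PathAlgebra.of_mul_of (p q : QPath V) :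
    PathAlgebra.of k p * PathAlgebra.of k q = pathMul k p q := by
  rw [PathAlgebra.mul_def]
  unfold mulHom PathAlgebra.of
  erw [Finsupp.linearCombination_single, one_smul, Finsupp.linearCombination_single, one_smul]

theorem PathAlgebra.ext_hom {M : Type*} [AddCommGroup M] [Module k M]
    {f g : PathAlgebra k V →ₗ[k] M}
    (h : ∀ p, f (PathAlgebra.of k p) = g (PathAlgebra.of k p)) : f = g :=
  Finsupp.lhom_ext' fun p => LinearMap.ext_ring (h p)

theorem PathAlgebra.mulHom_of (p q : QPath V) :
    mulHom k (PathAlgebra.of k p) (PathAlgebra.of k q) = pathMul k p q :=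
  PathAlgebra.of_mul_of k p q

theorem pathMul_assoc (p q r : QPath V) :
    mulHom k (pathMul k p q) (PathAlgebra.of k r) =
      mulHom k (PathAlgebra.of k p) (pathMul k q r) := by
  by_cases h₁ : p.tgt = q.start
  · by_cases h₂ : q.tgt = r.start
    · have h₃ : (p.comp q h₁).tgt = r.start := by rw [QPath.tgt_comp, h₂]
      have h₄ : p.tgt = (q.comp r h₂).start := h₁
      rw [pathMul, dif_pos h₁, pathMul, dif_pos h₂, PathAlgebra.mulHom_of,
        PathAlgebra.mulHom_of, pathMul, dif_pos h₃, pathMul, dif_pos h₄]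
      congr 1
      simp [QPath.comp]
    · have h₃ : ¬ (p.comp q h₁).tgt = r.start := by rw [QPath.tgt_comp]; exact h₂
      rw [pathMul, dif_pos h₁, PathAlgebra.mulHom_of, pathMul, dif_neg h₃, pathMul,
        dif_neg h₂, map_zero]
  · by_cases h₂ : q.tgt = r.start
    · have h₄ : ¬ p.tgt = (q.comp r h₂).start := h₁
      rw [pathMul, dif_neg h₁, pathMul, dif_pos h₂, PathAlgebra.mulHom_of, pathMul,
        dif_neg h₄, map_zero, LinearMap.zero_apply]
    · simp [pathMul, h₁, h₂]

theorem PathAlgebra.mul_assoc' (x y z : PathAlgebra k V) : x * y * z = x * (y * z) := by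
  have key : (LinearMap.compr₂ (mulHom k (V := V)) (mulHom k)) =
      LinearMap.compl₂ ((LinearMap.llcomp k _ _ _).comp (mulHom k (V := V))) (mulHom k) := by
    refine PathAlgebra.ext_hom k fun p => PathAlgebra.ext_hom k fun q =>
      PathAlgebra.ext_hom k fun r => ?_
    simp only [LinearMap.compr₂_apply, LinearMap.compl₂_apply, LinearMap.comp_apply,
      LinearMap.llcomp_apply, PathAlgebra.mulHom_of]
    exact pathMul_assoc k p q r
  exact congrArg (fun F => F x y z) key

variable [Fintype V]

instance : One (PathAlgebra k V) := ⟨∑ e : V, PathAlgebra.of k (QPath.vertex e)⟩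

theorem PathAlgebra.one_def :
    (1 : PathAlgebra k V) = ∑ e : V, PathAlgebra.of k (QPath.vertex e) := rfl

theorem PathAlgebra.one_mul' (x : PathAlgebra k V) : 1 * x = x := by
  have key : mulHom k (1 : PathAlgebra k V) = LinearMap.id := by
    refine PathAlgebra.ext_hom k fun p => ?_
    rw [PathAlgebra.one_def, map_sum, LinearMap.sum_apply]
    rw [Finset.sum_eq_single p.start]
    · rw [PathAlgebra.mulHom_of, pathMul, dif_pos (by rfl)]; rfl
    · intro e _ he
      rw [PathAlgebra.mulHom_of, pathMul, dif_neg]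
      exact he
    · simp
  rw [PathAlgebra.mul_def, key]; rfl

theorem PathAlgebra.mul_one' (x : PathAlgebra k V) : x * 1 = x := by
  have key : (mulHom k (V := V)).flip 1 = LinearMap.id := by
    refine PathAlgebra.ext_hom k fun p => ?_
    rw [LinearMap.flip_apply, PathAlgebra.one_def, map_sum]
    rw [Finset.sum_eq_single p.tgt]
    · rw [PathAlgebra.mulHom_of, pathMul, dif_pos (by rfl)]
      simp [QPath.comp, QPath.vertex]
    · intro e _ he
      rw [PathAlgebra.mulHom_of, pathMul, dif_neg]
      exact fun h => he h.symm
    · simp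
  rw [PathAlgebra.mul_def, ← LinearMap.flip_apply, key]; rfl

instance : Ring (PathAlgebra k V) where
  __ := (inferInstance : AddCommGroup (PathAlgebra k V))
  mul := (· * ·)
  one := 1
  left_distrib x y z := by simp only [PathAlgebra.mul_def, map_add]
  right_distrib x y z := by simp only [PathAlgebra.mul_def, map_add, LinearMap.add_apply]
  zero_mul x := by simp only [PathAlgebra.mul_def, map_zero, LinearMap.zero_apply]
  mul_zero x := by simp only [PathAlgebra.mul_def, map_zero]
  mul_assoc := PathAlgebra.mul_assoc' k
  one_mul := PathAlgebra.one_mul' k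
  mul_one := PathAlgebra.mul_one' k

instance : Algebra k (PathAlgebra k V) :=
  Algebra.ofModule
    (fun r x y => by simp only [PathAlgebra.mul_def, map_smul, LinearMap.smul_apply])
    (fun r x y => by simp only [PathAlgebra.mul_def, map_smul])

variable (V)

/-- The two-sided ideal `J` of `kQ` generated by the arrows. -/
def arrowIdeal : Ideal (PathAlgebra k V) :=
  (TwoSidedIdeal.span
    (Set.range fun α : Quiver.Total V => PathAlgebra.of k (QPath.ofArrow α))).asIdeal

instance : (arrowIdeal k V).IsTwoSided :=
  inferInstanceAs (TwoSidedIdeal.asIdeal _).IsTwoSided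

/-- The truncated quiver algebra `A = kQ / J^N`. -/
abbrev TruncAlgebra (N : ℕ) := PathAlgebra k V ⧸ (arrowIdeal k V) ^ N

variable {V}

/-- The class in `A` of a path of `Q`. -/
def pathClass (N : ℕ) (p : QPath V) : TruncAlgebra k V N :=
  Ideal.Quotient.mk _ (PathAlgebra.of k p)

/-- The span of the paths of length at least `N`. -/
def longPaths (N : ℕ) : Submodule k (PathAlgebra k V) :=
  Submodule.span k ((PathAlgebra.of k) '' {p : QPath V | N ≤ p.length})

theorem mul_mem_longPaths {a b : ℕ} {x y : PathAlgebra k V}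
    (hx : x ∈ longPaths k a) (hy : y ∈ longPaths k b) : x * y ∈ longPaths k (a + b) := by
  have h : Submodule.map₂ (mulHom k (V := V)) (longPaths k a) (longPaths k b) ≤
      longPaths k (a + b) := by
    unfold longPaths
    rw [Submodule.map₂_span_span, Submodule.span_le]
    rintro _ ⟨_, ⟨p, hp, rfl⟩, _, ⟨q, hq, rfl⟩, rfl⟩
    simp only [PathAlgebra.mulHom_of]
    by_cases h : p.tgt = q.start
    · rw [pathMul, dif_pos h]
      refine Submodule.subset_span ⟨_, ?_, rfl⟩
      change a ≤ p.arrows.length at hp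
      change b ≤ q.arrows.length at hq
      change a + b ≤ (p.arrows ++ q.arrows).length
      rw [List.length_append]
      omega
    · rw [pathMul, dif_neg h]
      exact Submodule.zero_mem _
  exact h (Submodule.apply_mem_map₂ _ hx hy)

theorem mem_longPaths_zero (x : PathAlgebra k V) : x ∈ longPaths k 0 := by
  have key : (longPaths k 0).mkQ = (0 : PathAlgebra k V →ₗ[k] _) := by
    refine PathAlgebra.ext_hom k fun p => ?_
    rw [LinearMap.zero_apply, Submodule.mkQ_apply, Submodule.Quotient.mk_eq_zero]
    exact Submodule.subset_span ⟨p, Nat.zero_le _, rfl⟩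
  rw [← Submodule.Quotient.mk_eq_zero, ← Submodule.mkQ_apply, key, LinearMap.zero_apply]

theorem arrowIdeal_le_longPaths {x : PathAlgebra k V} (hx : x ∈ arrowIdeal k V) :
    x ∈ longPaths k 1 := by
  let I : TwoSidedIdeal (PathAlgebra k V) := TwoSidedIdeal.mk' {x | x ∈ longPaths k 1}
    (Submodule.zero_mem (longPaths k 1))
    (fun {x y} (h₁ : x ∈ longPaths k 1) (h₂ : y ∈ longPaths k 1) => Submodule.add_mem _ h₁ h₂)
    (fun {x} (h : x ∈ longPaths k 1) => Submodule.neg_mem (longPaths k 1) h)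
    (fun {x y} (h : y ∈ longPaths k 1) =>
      mul_mem_longPaths k (a := 0) (b := 1) (mem_longPaths_zero k x) h)
    (fun {x y} (h : x ∈ longPaths k 1) =>
      mul_mem_longPaths k (a := 1) (b := 0) h (mem_longPaths_zero k y))
  have hle : TwoSidedIdeal.span
      (Set.range fun α : Quiver.Total V => PathAlgebra.of k (QPath.ofArrow α)) ≤ I := by
    rw [TwoSidedIdeal.span_le]
    rintro _ ⟨α, rfl⟩
    exact (TwoSidedIdeal.mem_mk' _ _ _ _ _ _ _).2
      (Submodule.subset_span ⟨_, by simp [QPath.length, QPath.ofArrow], rfl⟩)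
  exact (TwoSidedIdeal.mem_mk' _ _ _ _ _ _ _).1 (hle (TwoSidedIdeal.mem_asIdeal.1 hx))

theorem arrowIdeal_pow_le_longPaths (N : ℕ) {x : PathAlgebra k V}
    (hx : x ∈ (arrowIdeal k V) ^ N) : x ∈ longPaths k N := by
  induction N generalizing x with
  | zero => exact mem_longPaths_zero k x
  | succ N ih =>
    rw [Submodule.pow_succ] at hx
    refine Submodule.mul_induction_on hx (fun a ha b hb => ?_) (fun a b ha hb => ?_)
    · exact mul_mem_longPaths k (ih ha) (arrowIdeal_le_longPaths k hb)
    · exact Submodule.add_mem _ ha hb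

/-- Forget all paths of length at least `N`. -/
def truncate (N : ℕ) : PathAlgebra k V →ₗ[k] QPath V →₀ k :=
  Finsupp.linearCombination k fun p : QPath V =>
    if p.length < N then Finsupp.single p (1 : k) else 0

theorem truncate_of (N : ℕ) (p : QPath V) : truncate k N (PathAlgebra.of k p) =
    if p.length < N then Finsupp.single p (1 : k) else 0 := by
  unfold truncate PathAlgebra.of
  erw [Finsupp.linearCombination_single, one_smul]

theorem arrowIdeal_pow_le_ker_truncate (N : ℕ) :
    ((arrowIdeal k V) ^ N).restrictScalars k ≤ LinearMap.ker (truncate k N) := by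
  intro x hx
  have hx' := arrowIdeal_pow_le_longPaths k N ((Submodule.restrictScalars_mem k _ _).1 hx)
  suffices hle : longPaths k N ≤ LinearMap.ker (truncate k (V := V) N) from hle hx'
  unfold longPaths
  rw [Submodule.span_le]
  rintro _ ⟨p, hp, rfl⟩
  rw [SetLike.mem_coe, LinearMap.mem_ker, truncate_of, if_neg]
  exact not_lt.2 hp

/-- The coordinates of an element of `A` in the basis formed by the classes of the paths of
length less than `N`. -/
def coeff (N : ℕ) : TruncAlgebra k V N →ₗ[k] QPath V →₀ k :=
  (Submodule.liftQ _ (truncate k N) (arrowIdeal_pow_le_ker_truncate k N)).comp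
    (Submodule.Quotient.restrictScalarsEquiv k ((arrowIdeal k V) ^ N)).symm.toLinearMap

theorem coeff_pathClass (N : ℕ) (p : QPath V) : coeff k N (pathClass k N p) =
    if p.length < N then Finsupp.single p (1 : k) else 0 :=
  truncate_of k N p

end Algebra

/-! ### The reduced bar resolution -/

section Bar

/-- A composable sequence `v₁, …, v_m` of nontrivial paths that are nonzero in `A = kQ / J^N`,
with the vertex at which it starts. These sequences (for fixed `m`) form a basis of the
`m`-fold tensor power of `rad A` over `E = kQ₀`; for `m = 0` they are the vertices. -/
@[ext] structure BarTuple (V : Type u) [Quiver.{v} V] (N : ℕ) where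
  start : V
  factors : List (Word V)
  isWalk : IsWalk start factors.flatten
  bound : ∀ p ∈ factors, p ≠ [] ∧ p.length < N

/-- A basis element `a ⊗ v₁ ⊗ ⋯ ⊗ v_m ⊗ b` of `A ⊗_E (rad A)^{⊗_E m} ⊗_E A`: the paths `a`,
`v₁, …, v_m`, `b` are composable and nonzero in `A`, and `v₁, …, v_m` are nontrivial. -/
@[ext] structure BarGen (V : Type u) [Quiver.{v} V] (N : ℕ) where
  start : V
  left : Word V
  factors : List (Word V)
  right : Word V
  isWalk : IsWalk start (left ++ (factors.flatten ++ right))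
  left_lt : left.length < N
  right_lt : right.length < N
  bound : ∀ p ∈ factors, p ≠ [] ∧ p.length < N

namespace BarGen

variable {V : Type u} [Quiver.{v} V] {N : ℕ}

/-- The number of inner tensor factors. -/
def degree (x : BarGen V N) : ℕ := x.factors.length

/-- The outer left factor. -/
def leftPath (x : BarGen V N) : QPath V :=
  ⟨x.start, x.left, ((isWalk_append _ _ _).1 x.isWalk).1⟩

theorem isWalk_factors (x : BarGen V N) : IsWalk (walkEnd x.start x.left) x.factors.flatten :=
  ((isWalk_append _ _ _).1 ((isWalk_append _ _ _).1 x.isWalk).2).1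

/-- The inner factors. -/
def tuple (x : BarGen V N) : BarTuple V N :=
  ⟨walkEnd x.start x.left, x.factors, x.isWalk_factors, x.bound⟩

/-- The outer right factor. -/
def rightPath (x : BarGen V N) : QPath V :=
  ⟨walkEnd (walkEnd x.start x.left) x.factors.flatten, x.right,
    ((isWalk_append _ _ _).1 ((isWalk_append _ _ _).1 x.isWalk).2).2⟩

end BarGen

variable (k : Type w) [Field k] (V : Type u) [Quiver.{v} V] (N : ℕ)

/-- The reduced bar resolution: the direct sum over `m` of `A ⊗_E (rad A)^{⊗_E m} ⊗_E A`. -/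
abbrev BarChain := BarGen V N →₀ k

variable {V}

/-- The tensor `a ⊗ v₁ ⊗ ⋯ ⊗ v_m ⊗ b` of (the classes in `A` of) paths, the inner factors being
projected from `A = E ⊕ rad A` to `rad A`: it vanishes if consecutive factors are not composable,
if some factor has length at least `N`, or if some inner factor is trivial. -/
def tens (e : V) (a : Word V) (vs : List (Word V)) (b : Word V) : BarChain k V N :=
  if h : IsWalk e (a ++ (vs.flatten ++ b)) ∧ a.length < N ∧ b.length < N ∧
      ∀ p ∈ vs, p ≠ [] ∧ p.length < N then
    Finsupp.single ⟨e, a, vs, b, h.1, h.2.1, h.2.2.1, h.2.2.2⟩ 1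
  else 0

/-- The map `c ↦ a c b`, for a path `a` that starts at `e` and a path `b`. -/
def act (e : V) (a b : Word V) : BarChain k V N →ₗ[k] BarChain k V N :=
  Finsupp.linearCombination k fun y : BarGen V N =>
    tens k N e (a ++ y.left) y.factors (y.right ++ b)

/-- Multiply the `i`-th and the `(i+1)`-st factor (counted from `0`). -/
def mergeAt (i : ℕ) (vs : List (Word V)) : List (Word V) :=
  vs.take i ++ ((vs.drop i).take 2).flatten :: vs.drop (i + 2)

/-- The differential of the bar resolution: the alternating sum of the products of
neighbouring factors. -/
def barD : BarChain k V N →ₗ[k] BarChain k V N :=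
  Finsupp.linearCombination k fun x : BarGen V N =>
    match x.factors with
    | [] => 0
    | p :: ps =>
      tens k N x.start (x.left ++ p) ps x.right +
        ∑ i ∈ Finset.range ps.length,
          (-1 : k) ^ (i + 1) • tens k N x.start x.left (mergeAt i (p :: ps)) x.right +
        (-1 : k) ^ (ps.length + 1) •
          tens k N x.start x.left (p :: ps).dropLast ((p :: ps).getLastD [] ++ x.right)

/-- The contracting homotopy `a ⊗ x ↦ 1 ⊗ a_r ⊗ x`, where `a_r` is the component of `a` in
`rad A`. -/
def barS : BarChain k V N →ₗ[k] BarChain k V N :=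
  Finsupp.linearCombination k fun x : BarGen V N =>
    tens k N x.start [] (x.left :: x.factors) x.right

end Bar

/-! ### Bardzell's resolution -/

section Bardzell

/-- `IsConcatenationLength N m L`: a path of length `L` is the support of an `m`-concatenation of
relations, the relations being all paths of length `N`. For `m = 0, 1` the supports are the
vertices and the arrows. For `m ≥ 2` an `m`-concatenation in a path is a sequence of `m - 1`
relations dividing it, given here by their starting positions: the first one starts at position
`0`, the second one is the first relation to start strictly inside the first one, and each
further one is the first relation to start not before the end of the last but one relation and
strictly before the end of the last one; the support goes up to the end of the last relation. -/
def IsConcatenationLength (N : ℕ) : ℕ → ℕ → Prop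
  | 0, L => L = 0
  | 1, L => L = 1
  | m + 2, L => ∃ i : ℕ → ℕ, i 0 = 0 ∧
      (1 ≤ m → IsLeast {r | i 0 < r ∧ r < i 0 + N ∧ r + N ≤ L} (i 1)) ∧
      (∀ j, j + 2 ≤ m →
        IsLeast {r | i j + N ≤ r ∧ r < i (j + 1) + N ∧ r + N ≤ L} (i (j + 2))) ∧
      i m + N = L

/-- The length of the supports of `m`-concatenations: `cN` for `m = 2c`, and `cN + 1` for
`m = 2c + 1`. -/
def apLength (N m : ℕ) : ℕ := m / 2 * N + m % 2

theorem isConcatenationLength_iff {N : ℕ} (hN : 2 ≤ N) (m L : ℕ) :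
    IsConcatenationLength N m L ↔ L = apLength N m := by
  match m with
  | 0 => simp [IsConcatenationLength, apLength]
  | 1 => simp [IsConcatenationLength, apLength]
  | m + 2 =>
    have hap : apLength N (m + 2) = apLength N m + N := by
      have h₁ : (m + 2) / 2 = m / 2 + 1 := by omega
      have h₂ : (m + 2) % 2 = m % 2 := by omega
      rw [apLength, apLength, h₁, h₂]; ring
    have hstep : ∀ j, apLength N j < apLength N (j + 1) ∧
        apLength N (j + 1) < apLength N j + N := by
      intro j
      rcases Nat.even_or_odd' j with ⟨c, rfl | rfl⟩
      · have h₁ : 2 * c / 2 = c := by omega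
        have h₂ : 2 * c % 2 = 0 := by omega
        have h₃ : (2 * c + 1) / 2 = c := by omega
        have h₄ : (2 * c + 1) % 2 = 1 := by omega
        simp only [apLength, h₁, h₂, h₃, h₄]; omega
      · have h₁ : (2 * c + 1) / 2 = c := by omega
        have h₂ : (2 * c + 1) % 2 = 1 := by omega
        have h₃ : (2 * c + 1 + 1) / 2 = c + 1 := by omega
        have h₄ : (2 * c + 1 + 1) % 2 = 0 := by omega
        simp only [apLength, h₁, h₂, h₃, h₄, add_mul, one_mul]; omega
    have hap' : ∀ j, apLength N (j + 2) = apLength N j + N := by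
      intro j
      have h₁ : (j + 2) / 2 = j / 2 + 1 := by omega
      have h₂ : (j + 2) % 2 = j % 2 := by omega
      rw [apLength, apLength, h₁, h₂]; ring
    have h0 : apLength N 0 = 0 := by simp [apLength]
    have h1 : apLength N 1 = 1 := by simp [apLength]
    have hmono : StrictMono (apLength N) := strictMono_nat_of_lt_succ fun j => (hstep j).1
    rw [hap]
    constructor
    · rintro ⟨i, hi0, hi1, hi2, hL⟩
      have key : ∀ j, (j ≤ m → i j = apLength N j) ∧
          (j + 1 ≤ m → i (j + 1) = apLength N (j + 1)) := by
        intro j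
        induction j with
        | zero =>
          refine ⟨fun _ => by rw [hi0, h0], fun hj => ?_⟩
          have h := hi1 hj
          obtain ⟨⟨ha, hb, hc⟩, hmin⟩ := h
          have : i 1 ≤ 1 := hmin ⟨by omega, by omega, by omega⟩
          change i 1 = apLength N 1
          rw [h1]; omega
        | succ j ih =>
          refine ⟨ih.2, fun hj => ?_⟩
          obtain ⟨⟨ha, hb, hc⟩, hmin⟩ := hi2 j hj
          have hA := ih.1 (by omega)
          have hB := ih.2 (by omega)
          have hlt := (hstep j).1
          have : i (j + 2) ≤ i j + N := hmin ⟨le_rfl, by omega, by omega⟩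
          have e := hap' j
          have : j + 1 + 1 = j + 2 := rfl
          rw [this]; omega
      rw [← hL, (key m).1 le_rfl]
    · rintro rfl
      refine ⟨apLength N, h0, fun hm => ?_, fun j hj => ?_, rfl⟩
      · rw [h0, h1]
        have := hmono.monotone hm
        rw [h1] at this
        exact ⟨⟨by omega, by omega, by omega⟩, fun r hr => hr.1⟩
      · have e := hap' j
        have hlt := (hstep j).1
        have := hmono.monotone hj
        exact ⟨⟨by omega, by omega, by omega⟩, fun r hr => by rw [e]; exact hr.1⟩

variable (k : Type w) [Field k] (V : Type u) [Quiver.{v} V] (N : ℕ)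

/-- The set `AP_m` of supports of `m`-concatenations for the presentation `kQ / J^N`. -/
abbrev AP (m : ℕ) := {p : QPath V // IsConcatenationLength N m p.length}

/-- A basis element `a ⊗ ψ ⊗ b` of `A ⊗_E k AP_m ⊗_E A`: the paths `a`, `ψ`, `b` are composable,
`ψ` is in `AP_m`, and `a`, `b` are nonzero in `A`. -/
@[ext] structure BdzGen (m : ℕ) where
  start : V
  left : Word V
  mid : Word V
  right : Word V
  isWalk : IsWalk start (left ++ (mid ++ right))
  left_lt : left.length < N
  right_lt : right.length < N
  isConcat : IsConcatenationLength N m mid.length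

/-- The term `A ⊗_E k AP_m ⊗_E A` of Bardzell's resolution. -/
abbrev BdzChain (m : ℕ) := BdzGen V N m →₀ k

variable {V N}

namespace BdzGen

variable {m : ℕ}

/-- The outer left factor. -/
def leftPath (x : BdzGen V N m) : QPath V :=
  ⟨x.start, x.left, ((isWalk_append _ _ _).1 x.isWalk).1⟩

/-- The element of `AP_m`. -/
def midPath (x : BdzGen V N m) : AP V N m :=
  ⟨⟨walkEnd x.start x.left, x.mid,
    ((isWalk_append _ _ _).1 ((isWalk_append _ _ _).1 x.isWalk).2).1⟩, x.isConcat⟩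

/-- The outer right factor. -/
def rightPath (x : BdzGen V N m) : QPath V :=
  ⟨walkEnd (walkEnd x.start x.left) x.mid, x.right,
    ((isWalk_append _ _ _).1 ((isWalk_append _ _ _).1 x.isWalk).2).2⟩

end BdzGen

variable (N)

/-- The tensor `a ⊗ ψ ⊗ b`, for `ψ ∈ AP_m` and (the classes in `A` of) paths `a`, `b`. -/
def bdz (m : ℕ) (e : V) (a ψ b : Word V) : BdzChain k V N m :=
  if h : IsWalk e (a ++ (ψ ++ b)) ∧ a.length < N ∧ b.length < N ∧
      IsConcatenationLength N m ψ.length then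
    Finsupp.single ⟨e, a, ψ, b, h.1, h.2.1, h.2.2.1, h.2.2.2⟩ 1
  else 0

/-- Bardzell's differential from degree `m + 1` to degree `m`. For `m + 1` even, `1 ⊗ ψ ⊗ 1` is
sent to the sum of all `a ⊗ ψ' ⊗ b` with `ψ' ∈ AP_m` and `ψ = a ψ' b`; for `m + 1` odd there are
exactly two such divisors `ψ'` of `ψ`, at the positions `0` and `1`, and `1 ⊗ ψ ⊗ 1` is sent to
the difference, the second one minus the first one. -/
def bdzD (m : ℕ) : BdzChain k V N (m + 1) →ₗ[k] BdzChain k V N m :=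
  Finsupp.linearCombination k fun x : BdzGen V N (m + 1) =>
    ∑ i ∈ Finset.range (apLength N (m + 1) - apLength N m + 1),
      (if Even (m + 1) then (1 : k) else (-1) ^ (i + 1)) •
        bdz k N m x.start (x.left ++ x.mid.take i) ((x.mid.drop i).take (apLength N m))
          (x.mid.drop (i + apLength N m) ++ x.right)

end Bardzell

/-! ### The comparison maps and the homotopy -/

section Comparison

variable (k : Type w) [Field k] {V : Type u} [Quiver.{v} V] (N : ℕ)

/-- The comparison map `F_m` from Bardzell's resolution to the bar resolution:
`F_0 (a ⊗ e ⊗ b) = a ⊗ b`, and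
`F_{m+1} (1 ⊗ ψ ⊗ 1) = ∑ ± 1 ⊗ L(ψ') ⊗ F_m (1 ⊗ ψ' ⊗ 1) R(ψ')`, the sum being over the terms
`± L(ψ') ⊗ ψ' ⊗ R(ψ')` of the differential of `1 ⊗ ψ ⊗ 1`. -/
def mapF : (m : ℕ) → BdzChain k V N m →ₗ[k] BarChain k V N
  | 0 => Finsupp.linearCombination k fun x : BdzGen V N 0 =>
      tens k N x.start x.left [] x.right
  | m + 1 => Finsupp.linearCombination k fun x : BdzGen V N (m + 1) =>
      act k N x.start x.left x.right
        (barS k N (mapF m (bdzD k N m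
          (bdz k N (m + 1) (walkEnd x.start x.left) [] x.mid []))))

/-- For a sequence of an even number of paths, grouped into consecutive pairs: the product of
each pair is zero in `A`. -/
def PairsVanish {V : Type u} [Quiver.{v} V] (N : ℕ) : List (Word V) → Prop
  | [] => True
  | [_] => False
  | p :: q :: ps => N ≤ p.length + q.length ∧ PairsVanish N ps

/-- The comparison map `G_m` from the bar resolution to Bardzell's resolution.

For `m` even, `1 ⊗ v₁ ⊗ ⋯ ⊗ v_m ⊗ 1` is sent to `1 ⊗ ψ ⊗ b`, where `ψ ∈ AP_m` and
`v₁ ⋯ v_m = ψ b`, if `v₁v₂ = v₃v₄ = ⋯ = v_{m-1}v_m = 0` in `A`, and to `0` otherwise.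

For `m` odd, it is sent to the sum of all `a ⊗ ψ ⊗ b`, where `ψ ∈ AP_m`, `v₁ ⋯ v_m = a ψ b`
and `ψ` starts before the end of `v₁`, if `v₂v₃ = ⋯ = v_{m-1}v_m = 0` in `A`, and to `0`
otherwise. -/
def mapG (m : ℕ) : BarChain k V N →ₗ[k] BdzChain k V N m :=
  Finsupp.linearCombination k fun x : BarGen V N =>
    if x.factors.length = m then
      if Even m then
        if PairsVanish N x.factors then
          bdz k N m x.start x.left (x.factors.flatten.take (apLength N m))
            (x.factors.flatten.drop (apLength N m) ++ x.right)
        else 0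
      else
        if PairsVanish N x.factors.tail then
          ∑ j ∈ Finset.range (x.factors.headD []).length,
            bdz k N m x.start (x.left ++ x.factors.flatten.take j)
              ((x.factors.flatten.drop j).take (apLength N m))
              (x.factors.flatten.drop (j + apLength N m) ++ x.right)
        else 0
    else 0

/-- The homotopy `H_m` from degree `m` to degree `m + 1` of the bar resolution: `H_0 = 0`, and
`H_m` is the bimodule map with
`H_m (1 ⊗ x) = (s F_m G_m - s H_{m-1} d) (1 ⊗ x)`. -/
def mapH : ℕ → BarChain k V N →ₗ[k] BarChain k V N
  | 0 => 0
  | m + 1 => Finsupp.linearCombination k fun x : BarGen V N =>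
      if x.factors.length = m + 1 then
        act k N x.start x.left x.right
          (barS k N (mapF k N (m + 1) (mapG k N (m + 1)
              (tens k N (walkEnd x.start x.left) [] x.factors []))) -
            barS k N (mapH m (barD k N
              (tens k N (walkEnd x.start x.left) [] x.factors []))))
      else 0

end Comparison

/-! ### Cochains -/

section Cochains

variable (k : Type w) [Field k] (V : Type u) [Quiver.{v} V] [Fintype V] (N : ℕ)

/-- Hochschild cochains: the product over `m` of the spaces of linear maps from
`(rad A)^{⊗_E m}` to `A`, a linear map being given by its values on the basis. -/
abbrev BarCochain := BarTuple V N → TruncAlgebra k V N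

/-- Bardzell cochains: the product over `m` of the spaces of linear maps from `k AP_m` to `A`. -/
abbrev BdzCochain := (m : ℕ) → AP V N m → TruncAlgebra k V N

/-- `B^m(A) = Hom_{E-E}(k AP_m, A)`: the linear maps `f` with `f (e ψ e') = e f(ψ) e'` for all
vertices `e`, `e'`. -/
def Bardzell (m : ℕ) : Submodule k (AP V N m → TruncAlgebra k V N) where
  carrier := {f | ∀ (ψ : AP V N m) (e e' : V),
    pathClass k N (QPath.vertex e) * f ψ * pathClass k N (QPath.vertex e') =
      if e = ψ.1.start ∧ e' = ψ.1.tgt then f ψ else 0}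
  add_mem' {f g} hf hg ψ e e' := by
    rw [Pi.add_apply, mul_add, add_mul, hf ψ e e', hg ψ e e']
    split_ifs <;> simp
  zero_mem' ψ e e' := by simp
  smul_mem' c f hf ψ e e' := by
    rw [Pi.smul_apply, mul_smul_comm, smul_mul_assoc, hf ψ e e']
    split_ifs <;> simp

variable {V N}

/-- An element of `B^m(A)` as a cochain that vanishes in all other degrees. -/
def Bardzell.toCochain {m : ℕ} (f : Bardzell k V N m) : BdzCochain k V N := Pi.single m f.1

/-- The bimodule map `f̂` with `f̂ (a ⊗ x ⊗ b) = a f(x) b`. -/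
def BarCochain.hat (f : BarCochain k V N) : BarChain k V N →ₗ[k] TruncAlgebra k V N :=
  Finsupp.linearCombination k fun x : BarGen V N =>
    pathClass k N x.leftPath * f x.tuple * pathClass k N x.rightPath

/-- The bimodule map `f̂` with `f̂ (a ⊗ ψ ⊗ b) = a f(ψ) b`. -/
def BdzCochain.hat (f : BdzCochain k V N) (m : ℕ) :
    BdzChain k V N m →ₗ[k] TruncAlgebra k V N :=
  Finsupp.linearCombination k fun x : BdzGen V N m =>
    pathClass k N x.leftPath * f m x.midPath * pathClass k N x.rightPath

/-- `F^m (f) = f F_m`. -/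
def upperF (f : BarCochain k V N) : BdzCochain k V N := fun m ψ =>
  BarCochain.hat k f (mapF k N m (bdz k N m ψ.1.start [] ψ.1.arrows []))

/-- `G^m (f) = f G_m`. -/
def upperG (f : BdzCochain k V N) : BarCochain k V N := fun x =>
  BdzCochain.hat k f x.factors.length
    (mapG k N x.factors.length (tens k N x.start [] x.factors []))

/-- `(-1)^{m-1} H^m (f) = f H_{m-1}`; the result is evaluated here on sequences of length
`m - 1`. -/
def upperH (f : BarCochain k V N) : BarCochain k V N := fun x =>
  (-1 : k) ^ x.factors.length •
    BarCochain.hat k f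
      (mapH k N x.factors.length (tens k N x.start [] x.factors []))

/-- The differential of the shifted complex `B(A)[1]`: on `B^m(A)` it is
`f ↦ -(-1)^m f δ_{m+1}`. -/
def bdzDiff (f : BdzCochain k V N) : BdzCochain k V N
  | 0, _ => 0
  | m + 1, ψ => (-1 : k) ^ (m + 1) •
      BdzCochain.hat k f m (bdzD k N m (bdz k N (m + 1) ψ.1.start [] ψ.1.arrows []))

/-- The value of a cochain at `v₁ ⊗ ⋯ ⊗ v_m`, for classes in `A` of paths `v₁, …, v_m`, that are
projected from `A = E ⊕ rad A` to `rad A`. -/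
def BarCochain.eval (f : BarCochain k V N) (e : V) (vs : List (Word V)) : TruncAlgebra k V N :=
  if h : IsWalk e vs.flatten ∧ ∀ p ∈ vs, p ≠ [] ∧ p.length < N then f ⟨e, vs, h.1, h.2⟩ else 0

/-- `f (v₁ ⊗ ⋯ ⊗ v_i ⊗ g (v_{i+1} ⊗ ⋯ ⊗ v_{i+q}) ⊗ v_{i+q+1} ⊗ ⋯)`. -/
def BarCochain.insert (f g : BarCochain k V N) (i q : ℕ) (x : BarTuple V N) :
    TruncAlgebra k V N :=
  (coeff k N (BarCochain.eval k g (walkEnd x.start (x.factors.take i).flatten)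
      ((x.factors.drop i).take q))).sum fun p c =>
    c • BarCochain.eval k f x.start (x.factors.take i ++ p.arrows :: x.factors.drop (i + q))

/-- The Gerstenhaber product `f ∘ g = ∑_{i < p} (-1)^{i(q+1)} f (Id^i ⊗ g ⊗ Id^{p-i-1})` of a
`p`-cochain `f` and a `q`-cochain `g`; it is a `(p+q-1)`-cochain. -/
def gerstenhaberProduct (p q : ℤ) (f g : BarCochain k V N) : BarCochain k V N := fun x =>
  if (x.factors.length : ℤ) + 1 = p + q then
    ∑ i ∈ Finset.range p.toNat,
      ((i : ℤ) * (q + 1)).negOnePow • BarCochain.insert k f g i q.toNat x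
  else 0

/-- The Gerstenhaber bracket `[f, g] = f ∘ g - (-1)^{ab} g ∘ f` of elements of degrees `a` and
`b` in the shifted Hochschild complex, that is, of an `(a+1)`-cochain and a `(b+1)`-cochain. -/
def gerstenhaberBracket (a b : ℤ) (f g : BarCochain k V N) : BarCochain k V N :=
  gerstenhaberProduct k (a + 1) (b + 1) f g -
    (a * b).negOnePow • gerstenhaberProduct k (b + 1) (a + 1) g f

end Cochains

/-! ### Signs and unshuffles -/

section Signs

/-- The antisymmetric Koszul sign `χ(σ)` for elements of degrees `d 0, …, d (n-1)`. -/
def koszulChi {n : ℕ} (d : Fin n → ℤ) (σ : Equiv.Perm (Fin n)) : ℤˣ :=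
  Equiv.Perm.sign σ *
    ∏ i : Fin n, ∏ j : Fin n,
      if i < j ∧ σ j < σ i then (d (σ i) * d (σ j)).negOnePow else 1

/-- `|v_{σ(1)}| + ⋯ + |v_{σ(t)}|`. -/
def headDegree {n : ℕ} (d : Fin n → ℤ) (t : ℕ) (σ : Equiv.Perm (Fin n)) : ℤ :=
  ∑ p : Fin n, if p.val < t then d (σ p) else 0

/-- `|v_{σ(t+1)}| + ⋯ + |v_{σ(n)}|`. -/
def tailDegree {n : ℕ} (d : Fin n → ℤ) (t : ℕ) (σ : Equiv.Perm (Fin n)) : ℤ :=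
  ∑ p : Fin n, if t ≤ p.val then d (σ p) else 0

/-- The sign `κ(σ)_t`, with exponent `(t-1) + (n-t-1) (|v_{σ(1)}| + ⋯ + |v_{σ(t)}|)`. -/
def kappa {n : ℕ} (d : Fin n → ℤ) (t : ℕ) (σ : Equiv.Perm (Fin n)) : ℤˣ :=
  (((t : ℤ) - 1) + ((n : ℤ) - t - 1) * headDegree d t σ).negOnePow

/-- The `(t, n-t)`-unshuffles. -/
def unshuffles (n t : ℕ) : Finset (Equiv.Perm (Fin n)) :=
  Finset.univ.filter fun σ =>
    ∀ i j : Fin n, i < j → (j.val < t ∨ t ≤ i.val) → σ i < σ j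

/-- The `(t, n-t)`-unshuffles `σ` with `σ(1) < σ(t+1)`, where `t < n`. -/
def unshufflesMinus (n : ℕ) (t : Fin n) : Finset (Equiv.Perm (Fin n)) :=
  (unshuffles n t.val).filter fun σ => σ ⟨0, t.pos⟩ < σ t

end Signs

/-! ### The transferred structure -/

section Transfer

variable (k : Type w) [Field k] (V : Type u) [Quiver.{v} V] [Fintype V] (N : ℕ)

/-- An element of the shifted complex `B(A)[1]` together with its degree there. -/
structure ShiftedElt where
  deg : ℤ
  val : BdzCochain k V N

variable {V N}

/-- The formula for `v_n` in terms of the maps `φ_t` with `1 ≤ t < n`: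
`v_n = ∑_t ∑_τ χ(τ) κ(τ)_t [φ_t, φ_{n-t}] τ̂`, the inner sum being over `unshufflesMinus n t`. -/
def vFormula (φ : (n : ℕ) → (Fin n → ShiftedElt k V N) → BarCochain k V N) (n : ℕ)
    (f : Fin n → ShiftedElt k V N) : BarCochain k V N :=
  ∑ t : Fin n, if 1 ≤ t.val then
    ∑ τ ∈ unshufflesMinus n t,
      (koszulChi (fun i => (f i).deg) τ * kappa (fun i => (f i).deg) t.val τ) •
        gerstenhaberBracket k
          (headDegree (fun i => (f i).deg) t.val τ + 1 - t.val)
          (tailDegree (fun i => (f i).deg) t.val τ + 1 - ((n : ℤ) - t.val))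
          (φ t.val fun i => f (τ (Fin.castLE t.isLt.le i)))
          (φ (n - t.val) fun i => f (τ ⟨t.val + i.val, by omega⟩))
    else 0

/-- The formula for `u_n` in terms of the maps `l_k`, `φ_{n-k+1}` with `2 ≤ k ≤ n`:
`u_n = ∑_k ∑_τ (-1)^{k(n-k)+1} χ(τ) φ_{n-k+1} (l_k ⊗ Id^{n-k}) τ̂`, the inner sum being over the
`(k, n-k)`-unshuffles. -/
def uFormula (φ : (n : ℕ) → (Fin n → ShiftedElt k V N) → BarCochain k V N)
    (l : (n : ℕ) → (Fin n → ShiftedElt k V N) → BdzCochain k V N) (n : ℕ)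
    (f : Fin n → ShiftedElt k V N) : BarCochain k V N :=
  ∑ r : Fin (n + 1), if 2 ≤ r.val then
    ∑ τ ∈ unshuffles n r.val,
      (((r.val : ℤ) * ((n : ℤ) - r.val) + 1).negOnePow *
          koszulChi (fun i => (f i).deg) τ) •
        φ (n - r.val + 1) (Fin.cons
          ⟨headDegree (fun i => (f i).deg) r.val τ + 2 - r.val,
            l r.val fun i => f (τ (Fin.castLE (Nat.lt_succ_iff.1 r.isLt) i))⟩
          (fun i : Fin (n - r.val) => f (τ ⟨r.val + i.val, by omega⟩)))
    else 0

/-- The maps `φ_i` and `l_i` for `1 ≤ i ≤ n` (and junk for all other `i`), by recursion on `n`: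
`φ_1 = G`, `l_1` is the differential, and for `n ≥ 2` first `v_n` is computed, then
`l_n = F v_n`, then `u_n`, and then `φ_n = H (u_n + v_n)`. -/
def transferTable : ℕ → ((n : ℕ) → (Fin n → ShiftedElt k V N) → BarCochain k V N) ×
    ((n : ℕ) → (Fin n → ShiftedElt k V N) → BdzCochain k V N)
  | 0 => (fun _ _ => 0, fun _ _ => 0)
  | 1 => (Function.update (fun _ _ => 0) 1 fun f => upperG k (f 0).val,
      Function.update (fun _ _ => 0) 1 fun f => bdzDiff k (f 0).val)
  | n + 2 =>
    let φ := (transferTable (n + 1)).1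
    let l := Function.update (transferTable (n + 1)).2 (n + 2) fun f =>
      upperF k (vFormula k φ (n + 2) f)
    (Function.update φ (n + 2) fun f =>
      upperH k (uFormula k φ l (n + 2) f + vFormula k φ (n + 2) f), l)

/-- The maps `φ_n` on homogeneous elements. -/
def phi (n : ℕ) (f : Fin n → ShiftedElt k V N) : BarCochain k V N :=
  (transferTable k n).1 n f

/-- The brackets `l_n (f₁ ⊗ ⋯ ⊗ f_n)` of homogeneous elements of `B(A)[1]`. -/
def lBracket (n : ℕ) (f : Fin n → ShiftedElt k V N) : BdzCochain k V N :=
  (transferTable k n).2 n f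

theorem phi_one (f : Fin 1 → ShiftedElt k V N) : phi k 1 f = upperG k (f 0).val := by
  simp [phi, transferTable]

theorem lBracket_one (f : Fin 1 → ShiftedElt k V N) :
    lBracket k 1 f = bdzDiff k (f 0).val := by
  simp [lBracket, transferTable]

theorem transferTable_stable (m j : ℕ) :
    (transferTable k (m + j)).1 m = (phi k m : (Fin m → ShiftedElt k V N) → _) ∧
      (transferTable k (m + j)).2 m = (lBracket k m : (Fin m → ShiftedElt k V N) → _) := by
  induction j with
  | zero => exact ⟨rfl, rfl⟩
  | succ j ih =>
    match m, j with
    | 0, 0 => exact ⟨rfl, rfl⟩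
    | 0, j + 1 =>
      have e : 0 + (j + 1 + 1) = (0 + j) + 2 := by omega
      rw [e]
      simp only [transferTable]
      rw [Function.update_of_ne (by omega), Function.update_of_ne (by omega)]
      exact ih
    | m + 1, j =>
      have e : m + 1 + (j + 1) = (m + j) + 2 := by omega
      have e' : m + 1 + j = m + j + 1 := by omega
      rw [e]
      rw [e'] at ih
      simp only [transferTable]
      rw [Function.update_of_ne (by omega), Function.update_of_ne (by omega)]
      exact ih

theorem vFormula_congr {φ φ' : (n : ℕ) → (Fin n → ShiftedElt k V N) → BarCochain k V N}
    (n : ℕ) (h : ∀ t, 1 ≤ t → t < n → φ t = φ' t) (f : Fin n → ShiftedElt k V N) :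
    vFormula k φ n f = vFormula k φ' n f := by
  unfold vFormula
  refine Finset.sum_congr rfl fun t _ => ?_
  split_ifs with ht
  · rw [h t.val ht t.isLt, h (n - t.val) (by omega) (by omega)]
  · rfl

theorem uFormula_congr {φ φ' : (n : ℕ) → (Fin n → ShiftedElt k V N) → BarCochain k V N}
    {l l' : (n : ℕ) → (Fin n → ShiftedElt k V N) → BdzCochain k V N}
    (n : ℕ) (h : ∀ t, 1 ≤ t → t < n → φ t = φ' t) (h' : ∀ t, 2 ≤ t → t ≤ n → l t = l' t)
    (f : Fin n → ShiftedElt k V N) :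
    uFormula k φ l n f = uFormula k φ' l' n f := by
  unfold uFormula
  refine Finset.sum_congr rfl fun r _ => ?_
  split_ifs with hr
  · rw [h (n - r.val + 1) (by omega) (by omega), h' r.val hr (by omega)]
  · rfl

/-- The recursion `l_n = F v_n`. -/
theorem lBracket_eq (n : ℕ) (hn : 2 ≤ n) (f : Fin n → ShiftedElt k V N) :
    lBracket k n f = upperF k (vFormula k (phi k) n f) := by
  obtain ⟨n, rfl⟩ := Nat.exists_eq_add_of_le' hn
  have hφ : ∀ t, 1 ≤ t → t < n + 2 → (transferTable k (n + 1)).1 t =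
      (phi k t : (Fin t → ShiftedElt k V N) → _) := by
    intro t _ ht
    obtain ⟨j, hj⟩ := Nat.exists_eq_add_of_le (Nat.lt_succ_iff.1 ht)
    rw [hj]
    exact (transferTable_stable k t j).1
  have : lBracket k (n + 2) f =
      upperF k (vFormula k (transferTable k (n + 1)).1 (n + 2) f) := by
    simp [lBracket, transferTable]
  rw [this, vFormula_congr k _ hφ f]

/-- The recursion `φ_n = H (u_n + v_n)`. -/
theorem phi_eq (n : ℕ) (hn : 2 ≤ n) (f : Fin n → ShiftedElt k V N) :
    phi k n f = upperH k (uFormula k (phi k) (lBracket k) n f + vFormula k (phi k) n f) := by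
  obtain ⟨n, rfl⟩ := Nat.exists_eq_add_of_le' hn
  have hφ : ∀ t, 1 ≤ t → t < n + 2 → (transferTable k (n + 1)).1 t =
      (phi k t : (Fin t → ShiftedElt k V N) → _) := by
    intro t _ ht
    obtain ⟨j, hj⟩ := Nat.exists_eq_add_of_le (Nat.lt_succ_iff.1 ht)
    rw [hj]
    exact (transferTable_stable k t j).1
  have hl : ∀ t, 2 ≤ t → t ≤ n + 2 → (transferTable k (n + 2)).2 t =
      (lBracket k t : (Fin t → ShiftedElt k V N) → _) := by
    intro t _ ht
    obtain ⟨j, hj⟩ := Nat.exists_eq_add_of_le ht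
    rw [hj]
    exact (transferTable_stable k t j).2
  have : phi k (n + 2) f = upperH k
      (uFormula k (transferTable k (n + 1)).1 (transferTable k (n + 2)).2 (n + 2) f +
        vFormula k (transferTable k (n + 1)).1 (n + 2) f) := by
    simp [phi, transferTable]
  rw [this, vFormula_congr k _ hφ f, uFormula_congr k _ hφ hl f]

/-- An element of `B^2(A)` as an element of degree one of `B(A)[1]`. -/
def degreeOne (f : Bardzell k V N 2) : ShiftedElt k V N := ⟨1, Bardzell.toCochain k f⟩

/-- `f ∈ B^1(A)[1] = B^2(A)` is a Maurer-Cartan element: only finitely many brackets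
`l_n (f ⊗ ⋯ ⊗ f)` are nonzero, and
`l_1 (f) - ∑_{n ≥ 2} (-1)^{n(n+1)/2} / n! • l_n (f ⊗ ⋯ ⊗ f) = 0`. -/
def IsMaurerCartan (f : Bardzell k V N 2) : Prop :=
  {n : ℕ | lBracket k n (fun _ => degreeOne k f) ≠ 0}.Finite ∧
    lBracket k 1 (fun _ => degreeOne k f) -
      ∑ᶠ (n : ℕ) (_ : 2 ≤ n), ((-1 : k) ^ ((n + 1) * n / 2) / (n.factorial : k)) •
        lBracket k n (fun _ => degreeOne k f) = 0

end Transfer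

end TruncatedQuiver

end

/-!
The brackets `l_m` of elements of degree one are evaluated by looking only at which tensors can
occur in the chains involved; no sign and no coefficient has to be computed.

Since `s` kills every tensor `1 ⊗ x`, the recursions for `F` and `H` collapse in low degrees:
`F_3 (1 ⊗ ψ ⊗ 1)` is a combination of tensors `1 ⊗ β ⊗ a ⊗ α ⊗ b` with arrows `β` and `α`
(`mapF_three_mem`), and `H_2 (1 ⊗ v ⊗ w ⊗ 1)` is a combination of tensors
`1 ⊗ v ⊗ a ⊗ α ⊗ b` with `α` an arrow, `a` nontrivial and `w = a α b` (`mapH_two_mem`). Moreover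
`G_3` and `H_3` vanish on `1 ⊗ w ⊗ v ⊗ α ⊗ 1` if `α` is an arrow and `v α ≠ 0` in `A`.

It follows that `φ_r` with `r ≥ 2` vanishes on `v ⊗ α` for every arrow `α`
(`phi_eq_zero_of_right`), there being no suitable `a`. It also vanishes on `β ⊗ v` for every arrow
`β` (`phi_eq_zero_of_left`), by induction on `r`: its values there are combinations of values
of `u_r + v_r` on tensors `β ⊗ a ⊗ α` with `a α ≠ 0` in `A`. On these, `u_r` vanishes because every
`φ_j` does, and each term of `v_r` has an inner factor `φ_j (β ⊗ a)` or `φ_j (a ⊗ α)`, which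
vanishes by induction or by the first fact if `j ≥ 2`, and because the two paths have nonzero product
in `A` if `j = 1`.

Finally, `l_m = F^3 v_m` only involves values of `v_m` on tensors `β ⊗ a ⊗ α` with arrows `β` and
`α`. A term of `v_m` is a composition of some `φ_s` and `φ_t` with `s + t = m`; if `m ≥ 3`, one of
`s`, `t` is at least two, and that map is applied to a pair containing `β` on the left or `α` on
the right, so the term is zero (`vFormula_eq_zero_of_arrows`).
-/

namespace TruncatedQuiver

open scoped Classical

/-! ### Chains with prescribed tensors -/

section Support

variable {k : Type*} [Field k] {V : Type*} [Quiver V] {N : ℕ}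

/-- The chains all of whose basis elements `a ⊗ v₁ ⊗ ⋯ ⊗ v_m ⊗ b` satisfy the condition `P` on the
outer left factor `a` and the list `v₁, …, v_m` of inner factors. -/
def barSupp (k : Type*) [Field k] {V : Type*} [Quiver V] (N : ℕ)
    (P : Word V → List (Word V) → Prop) : Submodule k (BarChain k V N) :=
  Finsupp.supported k k {y | P y.left y.factors}

variable {P Q : Word V → List (Word V) → Prop}

theorem barSupp_mono (h : ∀ l f, P l f → Q l f) {c : BarChain k V N} (hc : c ∈ barSupp k N P) :
    c ∈ barSupp k N Q :=
  Finsupp.supported_mono (fun _ hy => h _ _ hy) hc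

theorem barSupp_inf {c : BarChain k V N} (hP : c ∈ barSupp k N P) (hQ : c ∈ barSupp k N Q) :
    c ∈ barSupp k N fun l f => P l f ∧ Q l f := fun _ hy => ⟨hP hy, hQ hy⟩

theorem tens_of_pos {e : V} {a : Word V} {vs : List (Word V)} {b : Word V}
    (h : IsWalk e (a ++ (vs.flatten ++ b)) ∧ a.length < N ∧ b.length < N ∧
      ∀ p ∈ vs, p ≠ [] ∧ p.length < N) :
    tens k N e a vs b =
      Finsupp.single ⟨e, a, vs, b, h.1, h.2.1, h.2.2.1, h.2.2.2⟩ 1 :=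
  dif_pos h

theorem tens_of_neg {e : V} {a : Word V} {vs : List (Word V)} {b : Word V}
    (h : ¬(IsWalk e (a ++ (vs.flatten ++ b)) ∧ a.length < N ∧ b.length < N ∧
      ∀ p ∈ vs, p ≠ [] ∧ p.length < N)) :
    tens k N e a vs b = 0 :=
  dif_neg h

theorem tens_mem_barSupp {e : V} {a : Word V} {vs : List (Word V)} {b : Word V}
    (h : (∀ p ∈ vs, p ≠ [] ∧ p.length < N) → P a vs) :
    tens k N e a vs b ∈ barSupp k N P := by
  unfold tens
  split_ifs with hw
  · exact Finsupp.single_mem_supported k _ (h hw.2.2.2)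
  · exact Submodule.zero_mem _

theorem linearCombination_mem_barSupp {T : BarGen V N → BarChain k V N}
    (h : ∀ y, P y.left y.factors → T y ∈ barSupp k N Q) {c : BarChain k V N}
    (hc : c ∈ barSupp k N P) : Finsupp.linearCombination k T c ∈ barSupp k N Q := by
  rw [Finsupp.linearCombination_apply]
  exact Submodule.sum_mem _ fun y hy =>
    Submodule.smul_mem _ _ (h y ((Finsupp.mem_supported _ _).1 hc hy))

theorem act_mem_barSupp {a : Word V} (h : ∀ l f, P l f → Q (a ++ l) f) (e : V) (b : Word V)
    {c : BarChain k V N} (hc : c ∈ barSupp k N P) : act k N e a b c ∈ barSupp k N Q :=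
  linearCombination_mem_barSupp (fun _ hy => tens_mem_barSupp fun _ => h _ _ hy) hc

theorem barS_mem_barSupp (h : ∀ l f, P l f → l ≠ [] → l.length < N → Q [] (l :: f))
    {c : BarChain k V N} (hc : c ∈ barSupp k N P) : barS k N c ∈ barSupp k N Q :=
  linearCombination_mem_barSupp (fun _ hy => tens_mem_barSupp fun hb =>
    h _ _ hy (hb _ List.mem_cons_self).1 (hb _ List.mem_cons_self).2) hc

theorem mem_barSupp_true (c : BarChain k V N) : c ∈ barSupp k N fun _ _ => True := by
  simp [barSupp]

theorem eq_zero_of_mem_barSupp_false {c : BarChain k V N} (hc : c ∈ barSupp k N P)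
    (h : ∀ l f, ¬ P l f) : c = 0 := by
  refine Finsupp.support_eq_empty.1 (Finset.eq_empty_of_forall_notMem fun y hy => ?_)
  exact h _ _ ((Finsupp.mem_supported _ _).1 hc hy)

/-- The contracting homotopy `s` kills every tensor whose outer left factor is trivial. -/
theorem barS_eq_zero {c : BarChain k V N} (hc : c ∈ barSupp k N fun l _ => l = []) :
    barS k N c = 0 :=
  eq_zero_of_mem_barSupp_false
    (barS_mem_barSupp (Q := fun _ _ => False) (fun _ _ h h' _ => h' h) hc) fun _ _ => id

theorem hat_eq_zero [Fintype V] {f : BarCochain k V N} {c : BarChain k V N}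
    (hc : c ∈ barSupp k N P) (h : ∀ x : BarTuple V N, ∀ l, P l x.factors → f x = 0) :
    BarCochain.hat k f c = 0 := by
  rw [BarCochain.hat, Finsupp.linearCombination_apply]
  refine Finset.sum_eq_zero fun y hy => ?_
  have := h y.tuple y.left ((Finsupp.mem_supported _ _).1 hc hy)
  simp only [this, mul_zero, zero_mul, smul_zero]

end Support

/-! ### The shape of `F` and of `H` -/

section Comparison

variable {k : Type*} [Field k] {V : Type*} [Quiver V] {N : ℕ}
variable {P : Word V → List (Word V) → Prop} {Q : List (Word V) → Prop}

theorem mapF_zero_mem (e : V) (a ψ b : Word V) :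
    mapF k N 0 (bdz k N 0 e a ψ b) ∈ barSupp k N fun l f => l = a ∧ f = [] := by
  unfold bdz
  split_ifs with h
  · rw [mapF, Finsupp.linearCombination_single, one_smul]
    exact tens_mem_barSupp fun _ => ⟨rfl, rfl⟩
  · rw [map_zero]; exact Submodule.zero_mem _

/-- In `F_{d+1} (a ⊗ ψ ⊗ b)` the outer left factor stays `a`, and the new first inner factor is a
left divisor of `ψ` that occurs in `δ_{d+1}`. -/
theorem mapF_succ_mem (d : ℕ)
    (hP : ∀ e l ψ b, l.length ≤ apLength N (d + 1) - apLength N d →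
      mapF k N d (bdz k N d e l ψ b) ∈ barSupp k N P)
    (hQ : ∀ l f, P l f → l ≠ [] → l.length < N → Q (l :: f)) (e : V) (a ψ b : Word V) :
    mapF k N (d + 1) (bdz k N (d + 1) e a ψ b) ∈ barSupp k N fun l f => l = a ∧ Q f := by
  unfold bdz
  split_ifs with h
  · rw [mapF, Finsupp.linearCombination_single, one_smul]
    refine act_mem_barSupp (P := fun l f => l = [] ∧ Q f)
      (fun l f hl => ⟨by simp [hl.1], hl.2⟩) _ _
      (barS_mem_barSupp (P := P) (fun l f h₁ h₂ h₃ => ⟨rfl, hQ l f h₁ h₂ h₃⟩) ?_)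
    unfold bdz
    split_ifs with h'
    · rw [bdzD, Finsupp.linearCombination_single, one_smul, map_sum]
      refine Submodule.sum_mem _ fun i hi => ?_
      rw [map_smul]
      refine Submodule.smul_mem _ _ (hP _ _ _ _ ?_)
      rw [Finset.mem_range] at hi
      rw [List.nil_append, List.length_take]
      omega
    · rw [map_zero, map_zero]; exact Submodule.zero_mem _
  · rw [map_zero]; exact Submodule.zero_mem _

theorem mapF_mem (d : ℕ) (e : V) (a ψ b : Word V) :
    mapF k N d (bdz k N d e a ψ b) ∈ barSupp k N fun l f => l = a ∧ f.length = d := by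
  induction d generalizing e a ψ b with
  | zero => exact barSupp_mono (fun l f h => ⟨h.1, by simp [h.2]⟩) (mapF_zero_mem e a ψ b)
  | succ d ih =>
    exact mapF_succ_mem (P := fun _ f => f.length = d) (Q := fun f => f.length = d + 1) d
      (fun e l ψ b _ => barSupp_mono (fun _ _ h => h.2) (ih e l ψ b))
      (fun l f h _ _ => by simp [h]) e a ψ b

theorem mapF_one_mem (e : V) (a ψ b : Word V) :
    mapF k N 1 (bdz k N 1 e a ψ b) ∈
      barSupp k N fun l f => l = a ∧ ∃ α : Word V, α.length = 1 ∧ f = [α] := by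
  refine mapF_succ_mem (P := fun l f => l.length ≤ 1 ∧ f = [])
    (Q := fun f => ∃ α : Word V, α.length = 1 ∧ f = [α]) 0 (fun e l ψ b hl =>
      barSupp_mono (fun l' f h => ⟨?_, h.2⟩) (mapF_zero_mem e l ψ b))
    ?_ e a ψ b
  · rintro l _ ⟨hl, rfl⟩ hl' _
    have := List.length_pos_iff.2 hl'
    exact ⟨l, by omega, rfl⟩
  · rw [h.1]; simpa [apLength] using hl

theorem mapF_two_mem (e : V) (a ψ b : Word V) :
    mapF k N 2 (bdz k N 2 e a ψ b) ∈
      barSupp k N fun l f => l = a ∧ ∃ v α : Word V, α.length = 1 ∧ f = [v, α] := by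
  refine mapF_succ_mem (P := fun _ f => ∃ α : Word V, α.length = 1 ∧ f = [α])
    (Q := fun f => ∃ v α : Word V, α.length = 1 ∧ f = [v, α]) 1 (fun e l ψ b hl =>
      barSupp_mono (fun l' f h => h.2) (mapF_one_mem e l ψ b)) ?_ e a ψ b
  rintro l _ ⟨α, hα, rfl⟩ _ _
  exact ⟨l, α, hα, rfl⟩

/-- `F_3` only involves tensors `1 ⊗ β ⊗ v ⊗ α ⊗ b` with arrows `β` and `α`: the left divisors in
`δ_3` have length at most one, and those in `F_1` are arrows. -/
theorem mapF_three_mem (e : V) (a ψ b : Word V) :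
    mapF k N 3 (bdz k N 3 e a ψ b) ∈ barSupp k N fun l f =>
      l = a ∧ ∃ β v α : Word V, β.length = 1 ∧ α.length = 1 ∧ f = [β, v, α] := by
  refine mapF_succ_mem
    (P := fun l f => l.length ≤ 1 ∧ ∃ v α : Word V, α.length = 1 ∧ f = [v, α])
    (Q := fun f => ∃ β v α : Word V, β.length = 1 ∧ α.length = 1 ∧ f = [β, v, α])
    2 (fun e l ψ b hl => barSupp_mono (fun l' f h => ⟨?_, h.2⟩) (mapF_two_mem e l ψ b))
    ?_ e a ψ b
  · rintro l _ ⟨hl, v, α, hα, rfl⟩ hl' _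
    have := List.length_pos_iff.2 hl'
    exact ⟨l, v, α, by omega, hα, rfl⟩
  · have h₂ : apLength N (2 + 1) - apLength N 2 = 1 := by simp [apLength]
    rw [h.1, ← h₂]; exact hl

/-- The homotopy `H_m` does not change the outer left factor. -/
theorem mapH_mem_left (m : ℕ) (a : Word V) {c : BarChain k V N}
    (hc : c ∈ barSupp k N fun l _ => l = a) : mapH k N m c ∈ barSupp k N fun l _ => l = a := by
  cases m with
  | zero => simp [mapH]
  | succ m =>
    rw [mapH]
    refine linearCombination_mem_barSupp (P := fun l _ => l = a) (fun y hy => ?_) hc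
    split_ifs
    · refine act_mem_barSupp (P := fun l _ => l = []) (fun l f h => by simp [h, hy]) _ _
        (Submodule.sub_mem _ ?_ ?_) <;>
      exact barS_mem_barSupp (P := fun _ _ => True) (fun _ _ _ _ _ => rfl) (mem_barSupp_true _)
    · exact Submodule.zero_mem _

/-- `s H_m` kills every tensor whose outer left factor is trivial. -/
theorem barS_mapH_eq_zero (m : ℕ) {c : BarChain k V N}
    (hc : c ∈ barSupp k N fun l _ => l = []) : barS k N (mapH k N m c) = 0 :=
  barS_eq_zero (mapH_mem_left m [] hc)

/-- Only the first summand of the bar differential of `1 ⊗ v ⊗ ⋯ ⊗ 1` has a nontrivial outer left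
factor, and so only this summand survives under `s H_m`. -/
theorem barS_mapH_barD_tens_nil (m : ℕ) (e : V) (v : Word V) (vs : List (Word V)) :
    barS k N (mapH k N m (barD k N (tens k N e [] (v :: vs) []))) ∈
      Submodule.span k {barS k N (mapH k N m (tens k N e v vs []))} := by
  by_cases h : IsWalk e ([] ++ ((v :: vs).flatten ++ [])) ∧ ([] : Word V).length < N ∧
      ([] : Word V).length < N ∧ ∀ p ∈ v :: vs, p ≠ [] ∧ p.length < N
  · rw [tens_of_pos h, barD, Finsupp.linearCombination_single, one_smul]
    simp only [List.nil_append]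
    rw [map_add, map_add, map_add, map_add, map_sum, map_sum]
    refine Submodule.add_mem _ (Submodule.add_mem _ (Submodule.mem_span_singleton_self _)
      (Submodule.sum_mem _ fun i _ => ?_)) ?_
    all_goals
      rw [map_smul, map_smul, barS_mapH_eq_zero m (tens_mem_barSupp fun _ => rfl), smul_zero]
      exact Submodule.zero_mem _
  · rw [tens_of_neg h]
    simp

/-- `H_{m+1} (a ⊗ v₁ ⊗ ⋯ ⊗ v_{m+1} ⊗ b)` is obtained from `s F G (1 ⊗ v₁ ⊗ ⋯ ⊗ 1)` and
`s H_m (v₁ ⊗ v₂ ⊗ ⋯ ⊗ 1)` alone, by multiplication with `a` and `b`. -/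
theorem mapH_succ_mem (m : ℕ) (e : V) (a v : Word V) (vs : List (Word V)) (b : Word V)
    (hlen : vs.length = m)
    (hG : barS k N (mapF k N (m + 1) (mapG k N (m + 1)
      (tens k N (walkEnd e a) [] (v :: vs) []))) ∈ barSupp k N fun _ f => Q f)
    (hH : barS k N (mapH k N m (tens k N (walkEnd e a) v vs [])) ∈
      barSupp k N fun _ f => Q f) :
    mapH k N (m + 1) (tens k N e a (v :: vs) b) ∈ barSupp k N fun _ f => Q f := by
  by_cases h : IsWalk e (a ++ ((v :: vs).flatten ++ b)) ∧ a.length < N ∧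
      b.length < N ∧ ∀ p ∈ v :: vs, p ≠ [] ∧ p.length < N
  · rw [tens_of_pos h, mapH, Finsupp.linearCombination_single, one_smul]
    rw [if_pos (by simp [hlen])]
    refine act_mem_barSupp (P := fun _ f => Q f) (fun _ _ h => h) _ _
      (Submodule.sub_mem _ hG ?_)
    exact (Submodule.span_singleton_le_iff_mem _ _).2 hH (barS_mapH_barD_tens_nil m _ v vs)
  · rw [tens_of_neg h, map_zero]
    exact Submodule.zero_mem _

end Comparison

/-! ### `G` and `H` in degrees at most three -/

section LowDegrees

variable {k : Type*} [Field k] {V : Type*} [Quiver V] {N : ℕ}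

/-- In even degrees `G` maps `1 ⊗ v₁ ⊗ ⋯ ⊗ v_m ⊗ b` to a tensor with trivial outer left factor. -/
theorem barS_mapF_mapG_eq_zero {m : ℕ} (hm : Even m) (e : V) (vs : List (Word V)) (b : Word V) :
    barS k N (mapF k N m (mapG k N m (tens k N e [] vs b))) = 0 := by
  by_cases h : IsWalk e ([] ++ (vs.flatten ++ b)) ∧ ([] : Word V).length < N ∧
      b.length < N ∧ ∀ p ∈ vs, p ≠ [] ∧ p.length < N
  · rw [tens_of_pos h, mapG, Finsupp.linearCombination_single, one_smul]
    simp only [if_pos hm]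
    split_ifs
    · exact barS_eq_zero (barSupp_mono (fun _ _ h => h.1) (mapF_mem m _ _ _ _))
    all_goals rw [map_zero, map_zero]
  · rw [tens_of_neg h, map_zero, map_zero, map_zero]

/-- `H_1 (a ⊗ v ⊗ b)` is a combination of the `a ⊗ x ⊗ α ⊗ c` with `v = x α y`, where `x` is
nontrivial and `α` is an arrow. -/
theorem mapH_one_mem (e : V) (a v b : Word V) :
    mapH k N 1 (tens k N e a [v] b) ∈ barSupp k N fun _ f =>
      ∃ x α : Word V, x ≠ [] ∧ x.length < v.length ∧ α.length = 1 ∧ f = [x, α] := by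
  refine mapH_succ_mem (Q := fun f => ∃ x α : Word V, x ≠ [] ∧ x.length < v.length ∧
    α.length = 1 ∧ f = [x, α]) 0 e a v [] b rfl ?_ ?_
  · refine barS_mem_barSupp
      (P := fun l f => l.length < v.length ∧ ∃ α : Word V, α.length = 1 ∧ f = [α]) ?_ ?_
    · rintro l _ ⟨hl, α, hα, rfl⟩ hl' _
      exact ⟨l, α, hl', hl, hα, rfl⟩
    by_cases h : IsWalk (walkEnd e a) ([] ++ ([v].flatten ++ [])) ∧ ([] : Word V).length < N ∧
      ([] : Word V).length < N ∧ ∀ p ∈ [v], p ≠ [] ∧ p.length < N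
    · rw [tens_of_pos h, mapG, Finsupp.linearCombination_single, one_smul]
      simp only [zero_add, List.length_singleton, if_true, Nat.not_even_one, if_false,
        List.tail_cons, PairsVanish, List.headD_cons]
      rw [map_sum]
      refine Submodule.sum_mem _ fun j hj => barSupp_mono (fun l f h => ⟨?_, h.2⟩)
        (mapF_one_mem _ _ _ _)
      rw [Finset.mem_range] at hj
      rw [h.1, List.nil_append, List.length_take]
      omega
    · rw [tens_of_neg h, map_zero, map_zero]
      exact Submodule.zero_mem _
  · rw [mapH, LinearMap.zero_apply, map_zero]
    exact Submodule.zero_mem _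

/-- `H_2 (a ⊗ v ⊗ w ⊗ b)` is a combination of the `a ⊗ v ⊗ x ⊗ α ⊗ c` with `w = x α y`, where `x`
is nontrivial and `α` is an arrow. -/
theorem mapH_two_mem (e : V) (a v w b : Word V) :
    mapH k N 2 (tens k N e a [v, w] b) ∈ barSupp k N fun _ f =>
      ∃ x α : Word V, x ≠ [] ∧ x.length < w.length ∧ α.length = 1 ∧ f = [v, x, α] := by
  refine mapH_succ_mem (Q := fun f => ∃ x α : Word V, x ≠ [] ∧ x.length < w.length ∧
    α.length = 1 ∧ f = [v, x, α]) 1 e a v [w] b rfl ?_ ?_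
  · rw [barS_mapF_mapG_eq_zero (m := 1 + 1) even_two]
    exact Submodule.zero_mem _
  · refine barS_mem_barSupp ?_ (barSupp_inf
      (mapH_mem_left 1 v (tens_mem_barSupp fun _ => rfl)) (mapH_one_mem _ v w []))
    rintro l _ ⟨rfl, x, α, h₁, h₂, h₃, rfl⟩ _ _
    exact ⟨x, α, h₁, h₂, h₃, rfl⟩

theorem not_pairsVanish_pair {v α : Word V} (hv : v.length + 1 < N) (hα : α.length = 1) :
    ¬ PairsVanish N [v, α] := by
  rw [PairsVanish, hα]
  omega

/-- `G_3` vanishes on `1 ⊗ w ⊗ v ⊗ α ⊗ 1` if `α` is an arrow and `v α` is nonzero in `A`. -/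
theorem mapG_three_eq_zero (e : V) {w v α : Word V} (hv : v.length + 1 < N)
    (hα : α.length = 1) : mapG k N 3 (tens k N e [] [w, v, α] []) = 0 := by
  by_cases h : IsWalk e ([] ++ ([w, v, α].flatten ++ [])) ∧ ([] : Word V).length < N ∧
      ([] : Word V).length < N ∧ ∀ p ∈ [w, v, α], p ≠ [] ∧ p.length < N
  · rw [tens_of_pos h, mapG, Finsupp.linearCombination_single, one_smul]
    simp only [List.tail_cons, if_neg (not_pairsVanish_pair hv hα),
      if_neg (show ¬ Even 3 by decide), ite_self]
  · rw [tens_of_neg h, map_zero]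

/-- `H_3` vanishes on `1 ⊗ w ⊗ v ⊗ α ⊗ 1` if `α` is an arrow and `v α` is nonzero in `A`. -/
theorem mapH_three_eq_zero (e : V) {w v α : Word V} (hv : v.length + 1 < N)
    (hα : α.length = 1) : mapH k N 3 (tens k N e [] [w, v, α] []) = 0 := by
  refine eq_zero_of_mem_barSupp_false (P := fun _ _ => False)
    (mapH_succ_mem (Q := fun _ => False) 2 e [] w [v, α] [] rfl ?_ ?_) fun _ _ => id
  · rw [mapG_three_eq_zero _ hv hα, map_zero, map_zero]
    exact Submodule.zero_mem _
  · refine barS_mem_barSupp ?_ (mapH_two_mem _ w v α [])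
    rintro _ _ ⟨x, β, h₁, h₂, _⟩
    have := List.length_pos_iff.2 h₁
    omega

/-- `G_2` vanishes on `1 ⊗ v ⊗ w ⊗ 1` if `v w` is nonzero in `A`. -/
theorem mapG_two_eq_zero (e : V) {v w : Word V} (hvw : v.length + w.length < N) :
    mapG k N 2 (tens k N e [] [v, w] []) = 0 := by
  by_cases h : IsWalk e ([] ++ ([v, w].flatten ++ [])) ∧ ([] : Word V).length < N ∧
      ([] : Word V).length < N ∧ ∀ p ∈ [v, w], p ≠ [] ∧ p.length < N
  · rw [tens_of_pos h, mapG, Finsupp.linearCombination_single, one_smul]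
    have hp : ¬ PairsVanish N [v, w] := by rw [PairsVanish]; omega
    simp only [if_neg hp, if_pos even_two, ite_self]
  · rw [tens_of_neg h, map_zero]

end LowDegrees

/-! ### Vanishing of the maps `φ_r` and of the higher brackets -/

section Brackets

variable {k : Type*} [Field k] {V : Type*} [Quiver V] [Fintype V] {N : ℕ}

theorem BarCochain.eval_eq_zero {f : BarCochain k V N} {e : V} {vs : List (Word V)}
    (h : ∀ x : BarTuple V N, x.factors = vs → f x = 0) : BarCochain.eval k f e vs = 0 := by
  rw [BarCochain.eval]
  split_ifs
  · exact h _ rfl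
  · rfl

theorem insert_eq_zero_of_inner {f g : BarCochain k V N} {i q : ℕ} {x : BarTuple V N}
    (h : ∀ y : BarTuple V N, y.factors = (x.factors.drop i).take q → g y = 0) :
    BarCochain.insert k f g i q x = 0 := by
  rw [BarCochain.insert, BarCochain.eval_eq_zero h, map_zero, Finsupp.sum_zero_index]

theorem insert_eq_zero_of_outer {f g : BarCochain k V N} {i q : ℕ} {x : BarTuple V N}
    (h : ∀ (y : BarTuple V N) (p : Word V),
      y.factors = x.factors.take i ++ p :: x.factors.drop (i + q) → f y = 0) :
    BarCochain.insert k f g i q x = 0 := by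
  rw [BarCochain.insert]
  refine Finset.sum_eq_zero fun p _ => ?_
  exact (congrArg _ (BarCochain.eval_eq_zero fun y hy => h y _ hy)).trans (smul_zero _)

/-- On elements of degree one, all brackets in `v_m` are brackets of `2`-cochains. -/
theorem vFormula_eq_zero (m : ℕ) (F : Fin m → ShiftedElt k V N) (hF : ∀ i, (F i).deg = 1)
    (x : BarTuple V N)
    (h : ∀ s t : ℕ, 1 ≤ s → 1 ≤ t → s + t = m → ∀ (F₁ : Fin s → ShiftedElt k V N)
      (F₂ : Fin t → ShiftedElt k V N), (∀ i, (F₁ i).deg = 1) → (∀ i, (F₂ i).deg = 1) →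
      x.factors.length = 3 → ∀ i < 2,
        BarCochain.insert k (phi k s F₁) (phi k t F₂) i 2 x = 0) :
    vFormula k (phi k) m F x = 0 := by
  have hd : (fun i => (F i).deg) = fun _ => 1 := funext hF
  have prod : ∀ s t : ℕ, 1 ≤ s → 1 ≤ t → s + t = m → ∀ (F₁ : Fin s → ShiftedElt k V N)
      (F₂ : Fin t → ShiftedElt k V N), (∀ i, (F₁ i).deg = 1) → (∀ i, (F₂ i).deg = 1) →
      gerstenhaberProduct k 2 2 (phi k s F₁) (phi k t F₂) x = 0 := by
    intro s t hs ht hst F₁ F₂ h₁ h₂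
    rw [gerstenhaberProduct]
    split_ifs with hx
    · refine Finset.sum_eq_zero fun i hi => ?_
      rw [show (2 : ℤ).toNat = 2 from rfl] at hi ⊢
      rw [h s t hs ht hst F₁ F₂ h₁ h₂ (by omega) i (Finset.mem_range.1 hi), smul_zero]
    · rfl
  rw [vFormula, Finset.sum_apply]
  refine Finset.sum_eq_zero fun t _ => ?_
  split_ifs with ht
  · rw [Finset.sum_apply]
    refine Finset.sum_eq_zero fun τ _ => ?_
    have hhead : headDegree (fun i => (F i).deg) t.val τ = t.val := by
      rw [hd, headDegree, Finset.sum_boole, Fin.card_filter_val_lt]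
      simp [t.isLt.le]
    have htail : tailDegree (fun i => (F i).deg) t.val τ = (m : ℤ) - t.val := by
      have : headDegree (fun _ => 1) t.val τ + tailDegree (fun i => (F i).deg) t.val τ = m := by
        rw [hd, headDegree, tailDegree, ← Finset.sum_add_distrib]
        rw [Finset.sum_congr rfl fun p _ => show _ = (1 : ℤ) by split_ifs <;> omega]
        simp
      rw [← hd, hhead] at this
      omega
    rw [hhead, htail, gerstenhaberBracket]
    have e₁ : (t.val : ℤ) + 1 - t.val + 1 = 2 := by ring
    have e₂ : (m : ℤ) - t.val + 1 - (m - t.val) + 1 = 2 := by ring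
    rw [e₁, e₂, Pi.smul_apply, Pi.sub_apply, Pi.smul_apply,
      prod _ _ ht (by omega) (by omega) _ _ (fun _ => hF _) (fun _ => hF _),
      prod _ _ (by omega) ht (by omega) _ _ (fun _ => hF _) (fun _ => hF _),
      smul_zero, sub_zero, smul_zero]
  · rfl

theorem phi_eq_zero_of_mapH {r : ℕ} (hr : 2 ≤ r) (F : Fin r → ShiftedElt k V N)
    {x : BarTuple V N} {d : ℕ} {vs : List (Word V)} (hx : x.factors = vs) (hd : vs.length = d)
    {P : Word V → List (Word V) → Prop}
    (hP : mapH k N d (tens k N x.start [] vs []) ∈ barSupp k N P)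
    (h : ∀ y : BarTuple V N, ∀ l, P l y.factors →
      uFormula k (phi k) (lBracket k) r F y = 0 ∧ vFormula k (phi k) r F y = 0) :
    phi k r F x = 0 := by
  subst hx hd
  rw [phi_eq k r hr, upperH, hat_eq_zero hP, smul_zero]
  intro y l hy
  rw [Pi.add_apply, (h y l hy).1, (h y l hy).2, add_zero]

theorem phi_one_eq_zero_of_mapG (F : Fin 1 → ShiftedElt k V N) {x : BarTuple V N} {d : ℕ}
    {vs : List (Word V)} (hx : x.factors = vs) (hd : vs.length = d)
    (h : mapG k N d (tens k N x.start [] vs []) = 0) : phi k 1 F x = 0 := by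
  subst hx hd
  rw [phi_one, upperG, h, map_zero]

/-- The values of `φ_r` at `v ⊗ α` vanish for `r ≥ 2` and every arrow `α`, since `H_2` vanishes
there. -/
theorem phi_eq_zero_of_right {r : ℕ} (hr : 2 ≤ r) (F : Fin r → ShiftedElt k V N)
    {x : BarTuple V N} {v α : Word V} (hx : x.factors = [v, α]) (hα : α.length = 1) :
    phi k r F x = 0 := by
  refine phi_eq_zero_of_mapH hr F hx rfl (mapH_two_mem _ [] v α []) ?_
  rintro y l ⟨z, β, h₁, h₂, _⟩
  have := List.length_pos_iff.2 h₁
  omega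

/-- The values of every `φ_r` at `w ⊗ v ⊗ α` vanish if `α` is an arrow and `v α` is nonzero in `A`,
since `G_3` and `H_3` vanish there. -/
theorem phi_eq_zero_of_three {r : ℕ} (hr : 1 ≤ r) (F : Fin r → ShiftedElt k V N)
    {x : BarTuple V N} {w v α : Word V} (hx : x.factors = [w, v, α])
    (hv : v.length + 1 < N) (hα : α.length = 1) : phi k r F x = 0 := by
  rcases hr.eq_or_lt with rfl | hr
  · exact phi_one_eq_zero_of_mapG F hx rfl (mapG_three_eq_zero _ hv hα)
  · refine phi_eq_zero_of_mapH hr F hx (d := 3) rfl (P := fun _ _ => False) ?_ fun _ _ => False.elim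
    rw [mapH_three_eq_zero _ hv hα]
    exact Submodule.zero_mem _

theorem phi_one_eq_zero (F : Fin 1 → ShiftedElt k V N) {x : BarTuple V N} {v w : Word V}
    (hx : x.factors = [v, w]) (hvw : v.length + w.length < N) : phi k 1 F x = 0 :=
  phi_one_eq_zero_of_mapG F hx rfl (mapG_two_eq_zero _ hvw)

theorem uFormula_eq_zero (r : ℕ) (F : Fin r → ShiftedElt k V N) {x : BarTuple V N}
    {w v α : Word V} (hx : x.factors = [w, v, α]) (hv : v.length + 1 < N)
    (hα : α.length = 1) : uFormula k (phi k) (lBracket k) r F x = 0 := by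
  rw [uFormula, Finset.sum_apply]
  refine Finset.sum_eq_zero fun j _ => ?_
  split_ifs
  · rw [Finset.sum_apply]
    refine Finset.sum_eq_zero fun τ _ => ?_
    rw [Pi.smul_apply, phi_eq_zero_of_three (by omega) _ hx hv hα, smul_zero]
  · rfl

/-- For elements of degree one, the values of `φ_r` at `β ⊗ v` vanish for `r ≥ 2` and every arrow
`β`. By the shape of `H_2` they are combinations of values of `u_r + v_r` at some `β ⊗ a ⊗ α`
with `a α` nonzero in `A`, where all terms vanish by induction. -/
theorem phi_eq_zero_of_left {r : ℕ} (hr : 2 ≤ r) (F : Fin r → ShiftedElt k V N)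
    (hF : ∀ i, (F i).deg = 1) {x : BarTuple V N} {β v : Word V} (hx : x.factors = [β, v])
    (hβ : β.length = 1) : phi k r F x = 0 := by
  induction r using Nat.strong_induction_on generalizing x v with
  | _ r ih =>
  have hvN : v.length < N := (x.bound v (by simp [hx])).2
  refine phi_eq_zero_of_mapH hr F hx rfl (mapH_two_mem _ [] β v []) ?_
  rintro y _ ⟨a, α, -, hav, hα, hy⟩
  have haN : a.length + 1 < N := by omega
  refine ⟨uFormula_eq_zero r F hy haN hα, vFormula_eq_zero r F hF y ?_⟩
  intro s t hs ht hst F₁ F₂ h₁ h₂ _ i hi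
  refine insert_eq_zero_of_inner fun z hz => ?_
  interval_cases i
  · have hz' : z.factors = [β, a] := by simpa [hy] using hz
    rcases ht.eq_or_lt with rfl | ht
    · exact phi_one_eq_zero F₂ hz' (by omega)
    · exact ih t (by omega) ht F₂ h₂ hz'
  · have hz' : z.factors = [a, α] := by simpa [hy] using hz
    rcases ht.eq_or_lt with rfl | ht
    · exact phi_one_eq_zero F₂ hz' (by omega)
    · exact phi_eq_zero_of_right ht F₂ hz' hα

/-- For `m ≥ 3` and elements of degree one, `v_m` vanishes on `β ⊗ a ⊗ α` for arrows `β` and `α`: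
every term of it contains a factor `φ_r` with `r ≥ 2` that is evaluated at a tensor with an arrow
as its first or last factor. -/
theorem vFormula_eq_zero_of_arrows {m : ℕ} (hm : 3 ≤ m) (F : Fin m → ShiftedElt k V N)
    (hF : ∀ i, (F i).deg = 1) {x : BarTuple V N} {β a α : Word V} (hx : x.factors = [β, a, α])
    (hβ : β.length = 1) (hα : α.length = 1) : vFormula k (phi k) m F x = 0 := by
  refine vFormula_eq_zero m F hF x fun s t hs ht hst F₁ F₂ h₁ h₂ _ i hi => ?_
  rcases ht.eq_or_lt with rfl | ht
  · refine insert_eq_zero_of_outer fun y p hy => ?_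
    interval_cases i
    · exact phi_eq_zero_of_right (by omega) F₁ (v := p) (α := α) (by simpa [hx] using hy) hα
    · exact phi_eq_zero_of_left (by omega) F₁ h₁ (β := β) (v := p) (by simpa [hx] using hy) hβ
  · refine insert_eq_zero_of_inner fun y hy => ?_
    interval_cases i
    · exact phi_eq_zero_of_left ht F₂ h₂ (β := β) (v := a) (by simpa [hx] using hy) hβ
    · exact phi_eq_zero_of_right ht F₂ (v := a) (α := α) (by simpa [hx] using hy) hα

theorem lBracket_eq_zero {m : ℕ} (hm : 3 ≤ m) (F : Fin m → ShiftedElt k V N)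
    (hF : ∀ i, (F i).deg = 1) : lBracket k m F = 0 := by
  rw [lBracket_eq k m (by omega)]
  funext d ψ
  rw [upperF]
  by_cases hd : d = 3
  · subst hd
    refine hat_eq_zero (mapF_three_mem _ _ _ _) ?_
    rintro x l ⟨-, β, a, α, hβ, hα, hx⟩
    exact vFormula_eq_zero_of_arrows hm F hF hx hβ hα
  · refine hat_eq_zero (mapF_mem _ _ _ _ _) fun x l hx => ?_
    exact vFormula_eq_zero m F hF x fun s t _ _ _ _ _ _ _ h => absurd (hx.2.symm.trans h) hd

theorem isMaurerCartan_iff (f : Bardzell k V N 2) :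
    IsMaurerCartan k f ↔ lBracket k 1 (fun _ => degreeOne k f) +
      (1 / 2 : k) • lBracket k 2 (fun _ => degreeOne k f) = 0 := by
  have h0 : ∀ m, 3 ≤ m → lBracket k m (fun _ => degreeOne k f) = 0 := fun m hm =>
    lBracket_eq_zero hm _ fun _ => rfl
  have hfin : {m : ℕ | lBracket k m (fun _ => degreeOne k f) ≠ 0}.Finite := by
    refine (Set.finite_lt_nat 3).subset fun m hm => ?_
    by_contra h
    exact hm (h0 m (not_lt.1 h))
  have hsum : ∑ᶠ (m : ℕ) (_ : 2 ≤ m), ((-1 : k) ^ ((m + 1) * m / 2) / (m.factorial : k)) •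
      lBracket k m (fun _ => degreeOne k f) =
        -((1 / 2 : k) • lBracket k 2 (fun _ => degreeOne k f)) := by
    rw [finsum_eq_single _ 2]
    · rw [finsum_eq_if, if_pos le_rfl, ← neg_smul]
      congr 1
      norm_num [Nat.factorial]
      ring
    · intro m hm
      rw [finsum_eq_if]
      split_ifs
      · rw [h0 m (by omega), smul_zero]
      · rfl
  rw [IsMaurerCartan, hsum, sub_neg_eq_add]
  exact and_iff_right hfin

end Brackets

end TruncatedQuiver

theorem mainTheorem4 (k : Type*) [Field k] [CharZero k] (V : Type*) [Quiver V] [Fintype V]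
    [∀ a b : V, Finite (a ⟶ b)] (n : ℕ) (hn : 2 ≤ n) :
    (∀ (m : ℕ), 3 ≤ m → ∀ f : Fin m → TruncatedQuiver.Bardzell k V n 2,
      TruncatedQuiver.lBracket k m (fun i => TruncatedQuiver.degreeOne k (f i)) = 0) ∧
    (∀ f : TruncatedQuiver.Bardzell k V n 2,
      TruncatedQuiver.IsMaurerCartan k f ↔
        TruncatedQuiver.lBracket k 1 (fun _ => TruncatedQuiver.degreeOne k f) +
          (1 / 2 : k) •
            TruncatedQuiver.lBracket k 2 (fun _ => TruncatedQuiver.degreeOne k f) = 0) :=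
  ⟨fun _ hm _ => TruncatedQuiver.lBracket_eq_zero hm _ fun _ => rfl,
    TruncatedQuiver.isMaurerCartan_iff⟩
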